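/- Let $E$ be a Hausdorff locally convex space over $\mathbb{C}$, let $E'$ be its topological dual, and let $(x'_n)_{n\in\mathbb{N}}$ be a sequence in $E'$. The sequence is called \emph{Eidelheit} if for every sequence $(a_n)_{n\in\mathbb{N}}$ of complex numbers there is $x\in E$ with $\langle x'_n,x\rangle=a_n$ for all $n\in\mathbb{N}$. The space $E$ is called \emph{$B$-complete} if a linear subspace $X\subseteq E'$ is weak$^*$ closed if and only if, for every equicontinuous set $A\subset E'$, the set $X\cap A$ is closed in $A$ with respect to the relative weak$^*$ topology. If $(x'_n)_n$ is Eidelheit, then: (P1) the functionals $x'_n$, $n\in\mathbb{N}$, are linearly independent (as a sequence; in particular they are pairwise distinct); (P2) for every equicontinuous set $A\subset E'$ the set $\operatorname{span}\{x'_n : n\in\mathbb{N}\}\cap A$ is contained in a finite-dimensional subspace of $E'$. Conversely, if $E$ is $B$-complete and $(x'_n)_n$ satisfies (P1) and (P2), then $(x'_n)_n$ is Eidelheit. -/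

import Mathlib

/-- A set `A` of continuous linear functionals on `E` is equicontinuous, as a family of functions
`E → ℂ`. The elements of the dual `E'` are taken in Mathlib's type `WeakDual ℂ E`, the space of all
continuous linear functionals on `E` with the weak* topology; the definition of equicontinuity
only uses the topology of `E`. -/
def IsEquicontinuousSet {E : Type*} [AddCommGroup E] [Module ℂ E] [TopologicalSpace E]
    (A : Set (WeakDual ℂ E)) : Prop :=
  Equicontinuous (fun (f : A) (x : E) => (f : WeakDual ℂ E) x)

/-- `E` is B-complete (a Pták space): a linear subspace `X` of `E'` is weak* closed if and only if
`X ∩ A` is closed in `A`, for the relative weak* topology, for every equicontinuous `A ⊆ E'`.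
The set `X ∩ A`, seen as a subset of the subspace `A`, is the preimage of `X` under the
inclusion `A → E'`. -/
def IsBComplete (E : Type*) [AddCommGroup E] [Module ℂ E] [TopologicalSpace E] : Prop :=
  ∀ X : Submodule ℂ (WeakDual ℂ E),
    IsClosed (X : Set (WeakDual ℂ E)) ↔
      ∀ A : Set (WeakDual ℂ E), IsEquicontinuousSet A →
        IsClosed ((fun f : A => (f : WeakDual ℂ E)) ⁻¹' (X : Set (WeakDual ℂ E)))

/-- A sequence of continuous linear functionals on `E` is Eidelheit: for every sequence `a` of
complex numbers, the system `⟨x' n, x⟩ = a n`, `n ∈ ℕ`, has a solution `x` in `E`. -/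
def IsEidelheit {E : Type*} [AddCommGroup E] [Module ℂ E] [TopologicalSpace E]
    (x' : ℕ → WeakDual ℂ E) : Prop :=
  ∀ a : ℕ → ℂ, ∃ x : E, ∀ n, x' n x = a n

/-- For every equicontinuous set `A ⊆ E'`, the set `span {x' n : n ∈ ℕ} ∩ A` is contained in a
finite-dimensional subspace of `E'`. -/
def EquicontinuousTracesFiniteDim {E : Type*} [AddCommGroup E] [Module ℂ E] [TopologicalSpace E]
    (x' : ℕ → WeakDual ℂ E) : Prop :=
  ∀ A : Set (WeakDual ℂ E), IsEquicontinuousSet A →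
    ∃ L : Submodule ℂ (WeakDual ℂ E), FiniteDimensional ℂ L ∧
      (Submodule.span ℂ (Set.range x') : Set (WeakDual ℂ E)) ∩ A ⊆ L

/-! An Eidelheit sequence turns every linear functional on its span into an evaluation, while
evaluations are bounded on equicontinuous sets; an infinite independent subset of a trace would
carry an unbounded one. Conversely, (P2) and B-completeness make every subspace of the span weak*
closed, in particular the kernel there of the functional `x' n ↦ a n`. Hahn–Banach yields a point
annihilating this kernel but not the whole span; a multiple of it solves the system. -/

/-- A linearly independent family can be sent to prescribed scalars by a linear functional. -/
theorem LinearIndependent.exists_linearMap_apply_eq {K V ι : Type*} [Field K] [AddCommGroup V]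
    [Module K V] {v : ι → V} (hv : LinearIndependent K v) (a : ι → K) :
    ∃ φ : V →ₗ[K] K, ∀ i, φ (v i) = a i := by
  obtain ⟨φ, hφ⟩ := LinearMap.exists_extend ((Module.Basis.span hv).constr K a)
  refine ⟨φ, fun i => ?_⟩
  have h := LinearMap.congr_fun hφ (Module.Basis.span hv i)
  rw [Module.Basis.constr_basis] at h
  simpa [Module.Basis.span_apply hv i] using h

/-- An equicontinuous set of continuous linear functionals is pointwise bounded. -/
theorem IsEquicontinuousSet.exists_norm_apply_le {E : Type*} [AddCommGroup E] [Module ℂ E]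
    [TopologicalSpace E] [ContinuousSMul ℂ E] {A : Set (WeakDual ℂ E)}
    (hA : IsEquicontinuousSet A) (x : E) : ∃ C : ℝ, ∀ f ∈ A, ‖f x‖ ≤ C := by
  have h0 := Metric.equicontinuousAt_iff_right.1 (hA 0) 1 one_pos
  have hc : Filter.Tendsto (fun n : ℕ => ((n : ℂ) + 1)⁻¹ • x) Filter.atTop (nhds 0) := by
    have h1 : Filter.Tendsto (fun n : ℕ => ((n : ℂ) + 1)⁻¹) Filter.atTop (nhds 0) := by
      simpa using tendsto_one_div_add_atTop_nhds_zero_nat (𝕜 := ℂ)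
    simpa using h1.smul_const x
  obtain ⟨n, hn⟩ := (hc.eventually h0).exists
  refine ⟨‖(n : ℂ) + 1‖, fun f hf => ?_⟩
  have h2 := hn ⟨f, hf⟩
  have hne : ((n : ℂ) + 1) ≠ 0 := Nat.cast_add_one_ne_zero n
  simp only [map_zero, map_smul, dist_zero_left, norm_smul, norm_inv] at h2
  rw [inv_mul_lt_iff₀ (norm_pos_iff.2 hne), mul_one] at h2
  exact h2.le

/-- A point outside a weak* closed subspace of the dual is separated from it by an evaluation. -/
theorem WeakDual.exists_apply_ne_zero_of_notMem {E : Type*} [AddCommGroup E] [Module ℂ E]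
    [TopologicalSpace E] {X : Submodule ℂ (WeakDual ℂ E)}
    (hX : IsClosed (X : Set (WeakDual ℂ E))) {f : WeakDual ℂ E} (hf : f ∉ X) :
    ∃ x : E, (∀ g ∈ X, g x = 0) ∧ f x ≠ 0 := by
  have : IsScalarTower ℝ ℂ (WeakDual ℂ E) := ⟨fun r c f =>
    DFunLike.ext _ _ fun x => smul_assoc r c (f x)⟩
  have : @LocallyConvexSpace ℝ (WeakDual ℂ E) _ _ AddCommGroup.toAddCommMonoid _ _ :=
    WeakBilin.locallyConvexSpace (B := topDualPairing ℂ E)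
  have hsep := RCLike.geometric_hahn_banach_closed_point (𝕜 := ℂ) (E := WeakDual ℂ E)
    (s := X) (x := f)
  obtain ⟨l, u, hl, hu⟩ := hsep (X.restrictScalars ℝ).convex hX hf
  have hl0 : ∀ g ∈ X, l g = 0 := by
    intro g hg
    by_contra hne
    -- Rescaling `g` makes `l` take the value `u`, against the strict bound on `X`.
    have h := hl (((u : ℂ) / l g) • g) (X.smul_mem _ hg)
    rw [map_smul, smul_eq_mul, div_mul_cancel₀ _ hne] at h
    simp at h
  have hu0 : 0 < u := by simpa using hl 0 X.zero_mem
  obtain ⟨x, hx⟩ := LinearMap.dualEmbedding_surjective (topDualPairing ℂ E) l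
  have hlx : ∀ g : WeakDual ℂ E, l g = g x := fun g => by rw [← hx]; rfl
  refine ⟨x, fun g hg => by rw [← hlx, hl0 g hg], fun h => ?_⟩
  rw [hlx, h] at hu
  simp only [map_zero] at hu
  exact lt_asymm hu0 hu

section

variable {E : Type*} [AddCommGroup E] [Module ℂ E] [TopologicalSpace E] {x' : ℕ → WeakDual ℂ E}

/-- For an Eidelheit sequence, every linear functional on the dual is an evaluation on its span. -/
theorem IsEidelheit.exists_apply_eq_on_span (h : IsEidelheit x') (φ : WeakDual ℂ E →ₗ[ℂ] ℂ) :
    ∃ x : E, ∀ f ∈ Submodule.span ℂ (Set.range x'), f x = φ f := by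
  obtain ⟨x, hx⟩ := h fun n => φ (x' n)
  refine ⟨x, fun f hf => ?_⟩
  induction hf using Submodule.span_induction with
  | mem f hf => obtain ⟨n, rfl⟩ := hf; exact hx n
  | zero => rw [map_zero]; rfl
  | add f g _ _ hf hg => rw [map_add, ← hf, ← hg]; rfl
  | smul c f _ hf => rw [map_smul, ← hf]; rfl

theorem IsEidelheit.linearIndependent (h : IsEidelheit x') : LinearIndependent ℂ x' := by
  rw [linearIndependent_iff']
  intro s c hc i hi
  obtain ⟨x, hx⟩ := h (Pi.single i 1)
  let ev : WeakDual ℂ E →ₗ[ℂ] ℂ := (topDualPairing ℂ E).flip x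
  have h0 := congrArg ev hc
  have h1 : ∀ n, ev (x' n) = (Pi.single i 1 : ℕ → ℂ) n := hx
  simpa [h1, Pi.single_apply, hi] using h0

theorem IsEidelheit.equicontinuousTracesFiniteDim [ContinuousSMul ℂ E] (h : IsEidelheit x') :
    EquicontinuousTracesFiniteDim x' := by
  intro A hA
  obtain ⟨t, hts, hspan, hli⟩ := exists_linearIndependent ℂ
    ((Submodule.span ℂ (Set.range x') : Set (WeakDual ℂ E)) ∩ A)
  have hfin : t.Finite := by
    by_contra hinf
    let e := Set.Infinite.natEmbedding t hinf
    -- The values `n` are unbounded along a sequence in `A`.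
    obtain ⟨φ, hφ⟩ := (hli.comp e e.injective).exists_linearMap_apply_eq fun n => (n : ℂ)
    obtain ⟨x, hx⟩ := h.exists_apply_eq_on_span φ
    obtain ⟨C, hC⟩ := hA.exists_norm_apply_le x
    obtain ⟨n, hn⟩ := exists_nat_gt C
    have h1 := hC _ (hts (e n).2).2
    have h2 : φ (e n) = n := hφ n
    rw [hx _ (hts (e n).2).1, h2, Complex.norm_natCast] at h1
    exact absurd hn (not_lt.2 h1)
  refine ⟨Submodule.span ℂ t, FiniteDimensional.span_of_finite ℂ hfin, ?_⟩
  rw [hspan]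
  exact Submodule.subset_span

/-- In a B-complete space, a subspace of the span of a sequence with finite-dimensional
equicontinuous traces is weak* closed. -/
theorem EquicontinuousTracesFiniteDim.isClosed_of_le_span (hE : IsBComplete E)
    (h : EquicontinuousTracesFiniteDim x') {X : Submodule ℂ (WeakDual ℂ E)}
    (hX : X ≤ Submodule.span ℂ (Set.range x')) : IsClosed (X : Set (WeakDual ℂ E)) := by
  refine (hE X).2 fun A hA => ?_
  obtain ⟨L, hL, hLA⟩ := h A hA
  have hXL : IsClosed ((X ⊓ L : Submodule ℂ (WeakDual ℂ E)) : Set (WeakDual ℂ E)) :=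
    Submodule.closed_of_finiteDimensional _
  -- Inside `A`, the subspaces `X` and `X ⊓ L` have the same trace.
  convert hXL.preimage (continuous_subtype_val (p := fun f => f ∈ A)) using 1
  ext f
  exact ⟨fun hf => ⟨hf, hLA ⟨hX hf, f.2⟩⟩, fun hf => hf.1⟩

theorem EquicontinuousTracesFiniteDim.isEidelheit (hE : IsBComplete E)
    (hli : LinearIndependent ℂ x') (h : EquicontinuousTracesFiniteDim x') : IsEidelheit x' := by
  intro a
  by_cases ha : ∀ n, a n = 0
  · exact ⟨0, fun n => by rw [ha n, map_zero]⟩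
  push Not at ha
  obtain ⟨m, hm⟩ := ha
  obtain ⟨φ, hφ⟩ := hli.exists_linearMap_apply_eq a
  have hmem : ∀ n, x' n ∈ Submodule.span ℂ (Set.range x') := fun n =>
    Submodule.subset_span ⟨n, rfl⟩
  have hcl := h.isClosed_of_le_span hE
    (inf_le_left : Submodule.span ℂ (Set.range x') ⊓ LinearMap.ker φ ≤ _)
  obtain ⟨x, hx, hne⟩ := WeakDual.exists_apply_ne_zero_of_notMem hcl
    (f := x' m) fun hf => hm (by rw [← hφ m]; exact hf.2)
  refine ⟨(a m / x' m x) • x, fun n => ?_⟩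
  -- This combination lies in the kernel of `φ`, so the values `x' n x` are proportional to `a n`.
  have h0 : (a m • x' n - a n • x' m) x = 0 := by
    refine hx _ ⟨Submodule.sub_mem _ (Submodule.smul_mem _ _ (hmem n))
      (Submodule.smul_mem _ _ (hmem m)), ?_⟩
    simp [hφ, mul_comm]
  have h1 : a m * x' n x - a n * x' m x = 0 := h0
  rw [map_smul, smul_eq_mul, div_mul_eq_mul_div, sub_eq_zero.1 h1, mul_div_cancel_right₀ _ hne]

end

theorem corollary3p2 {E : Type*} [AddCommGroup E] [Module ℂ E] [TopologicalSpace E]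
    [IsTopologicalAddGroup E] [ContinuousSMul ℂ E] [LocallyConvexSpace ℝ E] [T2Space E]
    (x' : ℕ → WeakDual ℂ E) :
    (IsEidelheit x' → LinearIndependent ℂ x' ∧ EquicontinuousTracesFiniteDim x') ∧
      (IsBComplete E → LinearIndependent ℂ x' → EquicontinuousTracesFiniteDim x' →
        IsEidelheit x') :=
  ⟨fun h => ⟨h.linearIndependent, h.equicontinuousTracesFiniteDim⟩,
    fun hE hli h => h.isEidelheit hE hli⟩
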